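/- Let $F_0=0$, $F_1=1$, $F_{t+2}=F_{t+1}+F_t$ be the Fibonacci numbers, let $\gamma=(3-\sqrt5)/2$, and let $\mathbf f=f_0f_1f_2\cdots=01001010\cdots$ be the Fibonacci word, that is, $f_j=\lfloor (j+2)\gamma\rfloor-\lfloor (j+1)\gamma\rfloor$ for $j\ge 0$. For integers $i,m,n\ge 0$ let $$T(i,m,n)=\sum_{k=0}^{m-1}\sum_{\ell=0}^{n-1} f_{i+k+\ell}$$ be the sum of the entries of the $m\times n$ matrix $(f_{i+k+\ell})_{0\le k<m,\,0\le \ell<n}$. Then: (a) for every integer $k\ge 0$, the number of distinct values of $T(i,F_{3k}/2,F_{3k}/2)$, taken over all $i\ge 0$, is at least $k+1$; (b) for every integer $n\ge 1$, $$T\Bigl(\tfrac{F_{6n-1}-1}{4},\tfrac{F_{6n}}2,\tfrac{F_{6n}}2\Bigr)-T\Bigl(\tfrac{F_{6n+2}-1}{4},\tfrac{F_{6n}}2,\tfrac{F_{6n}}2\Bigr)=2n;$$ (c) for every integer $n\ge 0$, $$T\Bigl(\tfrac{F_{6n+5}-1}{4},\tfrac{F_{6n+3}}2,\tfrac{F_{6n+3}}2\Bigr)-T\Bigl(\tfrac{F_{6n+2}-1}{4},\tfrac{F_{6n+3}}2,\tfrac{F_{6n+3}}2\Bigr)=2n+1.$$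 (All the fractions occurring as arguments of $T$ are integers.) -/

import Mathlib

/-- The slope `γ = (3 - √5) / 2` of the Fibonacci word. -/
noncomputable def fibSlope : ℝ := (3 - Real.sqrt 5) / 2

/-- The infinite Fibonacci word `f₀ f₁ f₂ ⋯ = 01001010⋯`, given by
`f_{n-1} = ⌊(n+1)γ⌋ - ⌊nγ⌋` for `n ≥ 1`; here `j = n - 1`. -/
noncomputable def fibWord (j : ℕ) : ℤ :=
  ⌊((j : ℝ) + 2) * fibSlope⌋ - ⌊((j : ℝ) + 1) * fibSlope⌋

/-- The `m × n` matrix `A(i,m,n)` whose successive rows are shifted length-`n` windows of the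
sequence `a`: its entry in row `k`, column `l` (counted from `0`) is `a (i + k + l)`. -/
def wordRectangle (a : ℕ → ℤ) (i m n : ℕ) : Matrix (Fin m) (Fin n) ℤ :=
  Matrix.of fun k l => a (i + k + l)

/-- The sum `T(i,m,n)` of all entries of `A(i,m,n)`. -/
def rectangleSum (a : ℕ → ℤ) (i m n : ℕ) : ℤ :=
  ∑ k : Fin m, ∑ l : Fin n, wordRectangle a i m n k l

/-!
With `G N = ⌊γ⌋ + ⌊2γ⌋ + ⋯ + ⌊Nγ⌋`, the Fibonacci word is the second difference of `G`, so
`T(i,m,n)` is a combination of four values of `G`. Since `F (j + 2) γ = F j + ψ ^ (j + 2)`, where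
`ψ` is the conjugate of the golden ratio, and no integer separates `nγ` from `nγ + ψ ^ (j + 2)` when
`0 < n < F (j + 3)`, the sum is self-similar: `G (F (j + 2) + M) = G (F (j + 2)) + M F j + G M` for
`M < F (j + 3)`. As `(F (3s + 8) - 1) / 4 = F (3s + 5) + (F (3s + 2) - 1) / 4`, this yields a closed
form of `G` at the points `(F (3s + 2) - 1) / 4`, with a drift `(-1) ^ (s + 1) s / 8` that accounts
for the unbounded differences in (b) and (c). Finally `T(i,m,n)` changes by at most one when `i`
grows by one, so it takes all the values between the two in (b) or (c), whence (a).
-/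

open Finset Real

theorem sum_range_add_eq_sub {M : Type*} [AddCommGroup M] {f F : ℕ → M}
    (hF : ∀ j, F (j + 1) - F j = f j) (c n : ℕ) :
    ∑ l ∈ range n, f (c + l) = F (c + n) - F c := by
  simpa only [← add_assoc, hF, add_zero] using sum_range_sub (fun l => F (c + l)) n

theorem rectangleSum_eq_sum_range (a : ℕ → ℤ) (i m n : ℕ) :
    rectangleSum a i m n = ∑ k ∈ range m, ∑ l ∈ range n, a (i + k + l) := by
  simp only [rectangleSum, wordRectangle, Matrix.of_apply, Finset.sum_range]

theorem rectangleSum_eq_of_second_difference {a g G : ℕ → ℤ}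
    (hg : ∀ j, g (j + 1) - g j = a j) (hG : ∀ j, G (j + 1) - G j = g j) (i m n : ℕ) :
    rectangleSum a i m n = G (i + n + m) - G (i + n) - (G (i + m) - G i) := by
  simp only [rectangleSum_eq_sum_range, sum_range_add_eq_sub hg, sum_sub_distrib,
    sum_range_add_eq_sub hG, add_right_comm i _ n]

section Floor

variable {R : Type*} [CommRing R] [LinearOrder R] [IsStrictOrderedRing R] [FloorRing R]

theorem floor_eq_floor_of_forall_mul_pos {x y : R} (h : ∀ p : ℤ, 0 < (x - p) * (y - p)) :
    ⌊x⌋ = ⌊y⌋ :=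
  eq_of_forall_le_iff fun p => by
    rw [Int.le_floor, Int.le_floor, ← sub_nonneg, ← sub_nonneg (a := y)]
    rcases pos_and_pos_or_neg_and_neg_of_mul_pos (h p) with ⟨hx, hy⟩ | ⟨hx, hy⟩
    · exact iff_of_true hx.le hy.le
    · exact iff_of_false hx.not_ge hy.not_ge

theorem abs_floor_sub_floor_sub_le_one {x y z w : R} (h : x - y = z - w) :
    |⌊x⌋ - ⌊y⌋ - (⌊z⌋ - ⌊w⌋)| ≤ 1 := by
  have lower : (-2 : R) < (⌊x⌋ - ⌊y⌋ - (⌊z⌋ - ⌊w⌋) : ℤ) := by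
    push_cast
    linarith [Int.lt_floor_add_one x, Int.floor_le y, Int.floor_le z, Int.lt_floor_add_one w]
  have upper : ((⌊x⌋ - ⌊y⌋ - (⌊z⌋ - ⌊w⌋) : ℤ) : R) < 2 := by
    push_cast
    linarith [Int.floor_le x, Int.lt_floor_add_one y, Int.lt_floor_add_one z, Int.floor_le w]
  norm_cast at lower upper
  rw [abs_le]
  omega

end Floor

section IntermediateValues

variable {g : ℕ → ℤ}

theorem uIcc_subset_range_of_abs_succ_sub_le_one (hg : ∀ i, |g (i + 1) - g i| ≤ 1) (a b : ℕ) :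
    Set.uIcc (g a) (g b) ⊆ Set.range g := by
  wlog hab : a ≤ b generalizing a b
  · rw [Set.uIcc_comm]
    exact this b a (le_of_not_ge hab)
  induction b, hab using Nat.le_induction with
  | base => simp
  | succ b _ ih =>
    intro v hv
    by_cases hvb : v ∈ Set.uIcc (g a) (g b)
    · exact ih hvb
    · have hstep := abs_le.1 (hg b)
      refine ⟨b + 1, ?_⟩
      simp only [Set.mem_uIcc] at hv hvb
      omega

theorem natAbs_sub_add_one_le_encard_range (hg : ∀ i, |g (i + 1) - g i| ≤ 1) (a b : ℕ) :
    (((g b - g a).natAbs + 1 : ℕ) : ℕ∞) ≤ (Set.range g).encard := by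
  have hsub := Set.encard_le_encard (uIcc_subset_range_of_abs_succ_sub_le_one hg a b)
  rwa [← coe_uIcc, Set.encard_coe_eq_coe_finsetCard, Int.card_uIcc] at hsub

end IntermediateValues

theorem neg_one_pow_three_mul {M : Type*} [Monoid M] [HasDistribNeg M] (s : ℕ) :
    (-1 : M) ^ (3 * s) = (-1) ^ s := by
  rw [pow_mul, Odd.neg_one_pow (by decide)]

theorem natCast_fib_add_two (n : ℕ) :
    (Nat.fib (n + 2) : ℤ) = Nat.fib n + Nat.fib (n + 1) := by
  exact_mod_cast Nat.fib_add_two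

theorem fib_mul_fib_add_two_sub_sq (j : ℕ) :
    (Nat.fib j : ℤ) * Nat.fib (j + 2) - Nat.fib (j + 1) ^ 2 = (-1) ^ (j + 1) := by
  have cassini := Int.fib_succ_mul_fib_pred_sub_fib_sq (j + 1 : ℕ)
  rw [Int.natAbs_natCast, Nat.cast_succ, add_sub_cancel_right] at cassini
  rw [mul_comm]
  exact cassini

theorem fib_add_six (n : ℕ) : Nat.fib (n + 6) = 4 * Nat.fib (n + 3) + Nat.fib n := by
  grind [Nat.fib_add_two]

theorem fib_three_mul_add_two_mod_four (s : ℕ) : Nat.fib (3 * s + 2) % 4 = 1 := by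
  induction s using Nat.twoStepInduction with
  | zero => rfl
  | one => rfl
  | more s ih _ =>
    rw [show 3 * (s + 2) + 2 = 3 * s + 2 + 6 by ring, fib_add_six]
    omega

theorem exists_eq_fib_combination (j : ℕ) (n p : ℤ) :
    ∃ u w : ℤ, n = u * Nat.fib (j + 2) + w * Nat.fib (j + 3) ∧
      p = u * Nat.fib j + w * Nat.fib (j + 1) := by
  have cassini := fib_mul_fib_add_two_sub_sq j
  -- By Cassini's identity the determinant of this linear system in `u` and `w` is `±1`.
  have sq_sign : ((-1 : ℤ) ^ j) * (-1) ^ j = 1 := by simp [← mul_pow]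
  refine ⟨(-1) ^ j * (Nat.fib (j + 1) * n - Nat.fib (j + 3) * p),
    (-1) ^ j * (Nat.fib (j + 2) * p - Nat.fib j * n), ?_, ?_⟩
  all_goals
    simp only [Nat.fib_add_two (n := j + 1), Nat.fib_add_two (n := j)] at cassini ⊢
    push_cast at cassini ⊢
    grind

theorem fibSlope_eq_goldenConj_sq : fibSlope = goldenConj ^ 2 := by
  rw [goldenConj_sq, fibSlope, goldenConj]
  ring

theorem fib_add_two_mul_fibSlope (j : ℕ) :
    Nat.fib (j + 2) * fibSlope = Nat.fib j + goldenConj ^ (j + 2) := by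
  have hψ := goldenConj_mul_fib_succ_add_fib (j + 1)
  have hrec : (Nat.fib (j + 2) : ℝ) = Nat.fib j + Nat.fib (j + 1) := by
    exact_mod_cast Nat.fib_add_two
  rw [fibSlope_eq_goldenConj_sq, goldenConj_sq]
  linear_combination hψ + hrec

theorem pos_and_nonpos_or_neg_and_pos {a b u w : ℤ} (ha : 0 ≤ a) (hpos : 0 < u * a + w * b)
    (hlt : u * a + w * b < b) : 0 < u ∧ w ≤ 0 ∨ u < 0 ∧ 0 < w := by
  rcases le_or_gt w 0 with hw | hw
  · refine .inl ⟨?_, hw⟩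
    by_contra! hu
    nlinarith
  · refine .inr ⟨?_, hw⟩
    by_contra! hu
    nlinarith

theorem fib_combination_mul_fibSlope_sub (j : ℕ) (u w : ℤ) :
    (u * Nat.fib (j + 2) + w * Nat.fib (j + 3) : ℤ) * fibSlope
        - (u * Nat.fib j + w * Nat.fib (j + 1) : ℤ)
      = goldenConj ^ (j + 2) * (u + w * goldenConj) := by
  push_cast
  linear_combination u * fib_add_two_mul_fibSlope j + w * fib_add_two_mul_fibSlope (j + 1)

theorem add_mul_goldenConj_mul_succ_pos {u w : ℤ} (h : 0 < u ∧ w ≤ 0 ∨ u < 0 ∧ 0 < w) :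
    0 < (u + w * goldenConj) * (u + w * goldenConj + 1) := by
  rcases h with ⟨hu, hw⟩ | ⟨hu, hw⟩
  · have hu : (0 : ℝ) < u := by exact_mod_cast hu
    have hw : 0 ≤ w * goldenConj :=
      mul_nonneg_of_nonpos_of_nonpos (by exact_mod_cast hw) goldenConj_neg.le
    have hsum := add_pos_of_pos_of_nonneg hu hw
    exact mul_pos hsum (add_pos hsum one_pos)
  · have hu : (u : ℝ) + 1 ≤ 0 := by exact_mod_cast hu
    have hw : w * goldenConj < 0 := mul_neg_of_pos_of_neg (by exact_mod_cast hw) goldenConj_neg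
    exact mul_pos_of_neg_of_neg (by linarith) (by linarith)

/-- No integer separates `nγ` from `nγ + ψ ^ (j + 2)`. -/
theorem mul_fibSlope_sub_mul_add_pow_sub_pos {j : ℕ} {n : ℤ} (hn : 0 < n)
    (hlt : n < Nat.fib (j + 3)) (p : ℤ) :
    0 < (n * fibSlope - p) * (n * fibSlope + goldenConj ^ (j + 2) - p) := by
  obtain ⟨u, w, rfl, rfl⟩ := exists_eq_fib_combination j n p
  have hsign := pos_and_nonpos_or_neg_and_pos (Int.natCast_nonneg _) hn hlt
  have hpow : goldenConj ^ (j + 2) ≠ 0 := pow_ne_zero _ goldenConj_ne_zero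
  rw [add_sub_right_comm, fib_combination_mul_fibSlope_sub]
  calc
    0 < (goldenConj ^ (j + 2)) ^ 2 * ((u + w * goldenConj) * (u + w * goldenConj + 1)) :=
      mul_pos (by positivity) (add_mul_goldenConj_mul_succ_pos hsign)
    _ = _ := by ring

/-- The number `⌊nγ⌋`, which for `n ≥ 1` counts the ones among the first `n - 1` letters of the
Fibonacci word. -/
noncomputable def fibFloor (n : ℕ) : ℤ := ⌊n * fibSlope⌋

theorem fibFloor_add_two_sub_fibFloor_add_one (j : ℕ) :
    fibFloor (j + 2) - fibFloor (j + 1) = fibWord j := by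
  simp only [fibFloor, fibWord, Nat.cast_add, Nat.cast_ofNat, Nat.cast_one]

theorem fibFloor_fib_add {j n : ℕ} (hn : 0 < n) (hlt : n < Nat.fib (j + 3)) :
    fibFloor (Nat.fib (j + 2) + n) = Nat.fib j + fibFloor n := by
  have hsep : ⌊n * fibSlope⌋ = ⌊n * fibSlope + goldenConj ^ (j + 2)⌋ :=
    floor_eq_floor_of_forall_mul_pos fun p => by
      exact_mod_cast mul_fibSlope_sub_mul_add_pow_sub_pos
        (by exact_mod_cast hn) (by exact_mod_cast hlt) p
  rw [fibFloor, fibFloor, hsep, ← Int.floor_natCast_add, Nat.cast_add, add_mul,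
    fib_add_two_mul_fibSlope]
  congr 1
  ring

theorem fibFloor_eq_zero {n : ℕ} (hn : n ≤ 2) : fibFloor n = 0 := by
  have h_two_lt : 2 < √5 := lt_sqrt_of_sq_lt (by norm_num)
  have h_lt_three : √5 < 3 := (sqrt_lt' (by norm_num)).2 (by norm_num)
  have hn : (n : ℝ) ≤ 2 := by exact_mod_cast hn
  rw [fibFloor, Int.floor_eq_zero_iff, fibSlope]
  constructor
  · exact mul_nonneg n.cast_nonneg (by linarith)
  · nlinarith

/-- The sum `⌊γ⌋ + ⌊2γ⌋ + ⋯ + ⌊Nγ⌋`, whose second difference is the Fibonacci word. -/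
noncomputable def fibFloorSum (N : ℕ) : ℤ := ∑ r ∈ range N, fibFloor (r + 1)

theorem fibFloorSum_succ (N : ℕ) : fibFloorSum (N + 1) = fibFloorSum N + fibFloor (N + 1) :=
  sum_range_succ _ _

theorem fibFloorSum_eq_zero {N : ℕ} (hN : N ≤ 2) : fibFloorSum N = 0 :=
  sum_eq_zero fun _ hr => fibFloor_eq_zero (by grind)

theorem fibFloorSum_fib_add {j M : ℕ} (hM : M < Nat.fib (j + 3)) :
    fibFloorSum (Nat.fib (j + 2) + M)
      = fibFloorSum (Nat.fib (j + 2)) + M * Nat.fib j + fibFloorSum M := by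
  have hterm : ∀ r ∈ range M,
      fibFloor (Nat.fib (j + 2) + (r + 1)) = Nat.fib j + fibFloor (r + 1) := fun r hr =>
    fibFloor_fib_add r.succ_pos (lt_of_le_of_lt (mem_range.1 hr) hM)
  simp only [fibFloorSum, sum_range_add, add_assoc, sum_congr rfl hterm, sum_add_distrib,
    sum_const, card_range, nsmul_eq_mul]

theorem two_mul_fibFloorSum_fib (j : ℕ) :
    2 * fibFloorSum (Nat.fib (j + 2))
      = Nat.fib (j + 2) * Nat.fib j - Nat.fib (j + 1) + (-1) ^ j := by
  induction j using Nat.twoStepInduction with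
  | zero => simp [fibFloorSum_eq_zero]
  | one => simp [fibFloorSum_eq_zero, Nat.fib_add_two]
  | more j ih₀ ih₁ =>
    have hlt : Nat.fib (j + 2) < Nat.fib (j + 4) := (Nat.fib_lt_fib (by omega)).2 (by omega)
    have hsplit := fibFloorSum_fib_add hlt
    rw [add_comm (Nat.fib _), ← Nat.fib_add_two] at hsplit
    have cassini := fib_mul_fib_add_two_sub_sq j
    simp only [hsplit, add_assoc, Nat.reduceAdd, natCast_fib_add_two] at ih₀ ih₁ cassini ⊢
    linear_combination ih₀ + ih₁ - cassini

theorem thirtyTwo_mul_fibFloorSum_quarter_fib {s x : ℕ} (hx : 4 * x + 1 = Nat.fib (3 * s + 2)) :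
    32 * fibFloorSum x = Nat.fib (3 * s) * Nat.fib (3 * s + 2) - 2 * Nat.fib (3 * s + 3) + 3
      - (-1) ^ s * (4 * s - 1) := by
  induction s using Nat.twoStepInduction generalizing x with
  | zero =>
    obtain rfl : x = 0 := by simpa using hx
    simp [fibFloorSum_eq_zero, Nat.fib_add_two]
  | one =>
    obtain rfl : x = 1 := by simpa [Nat.fib_add_two] using hx
    simp [fibFloorSum_eq_zero, Nat.fib_add_two]
  | more s ih _ =>
    rw [show 3 * (s + 2) + 2 = 3 * s + 2 + 6 by ring, fib_add_six] at hx
    obtain ⟨y, rfl⟩ : ∃ y, x = Nat.fib (3 * s + 5) + y := Nat.exists_eq_add_of_le (by grind)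
    have hy : 4 * y + 1 = Nat.fib (3 * s + 2) := by grind
    have hlt : y < Nat.fib (3 * s + 6) := by grind [Nat.fib_add_two]
    have hsplit := fibFloorSum_fib_add hlt
    have hfib := two_mul_fibFloorSum_fib (3 * s + 3)
    have hy_cast : (4 * y + 1 : ℤ) = Nat.fib (3 * s + 2) := by exact_mod_cast hy
    have cassini := fib_mul_fib_add_two_sub_sq (3 * s)
    rw [hsplit]
    simp only [mul_add, add_assoc, Nat.reduceAdd, Nat.reduceMul, natCast_fib_add_two, pow_add,
      neg_one_pow_three_mul] at ih hfib hy_cast cassini ⊢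
    push_cast
    linear_combination ih hy + 16 * hfib - 8 * cassini
      + 8 * (Nat.fib (3 * s) + 2 * Nat.fib (3 * s + 1)) * hy_cast

theorem rectangleSum_fibWord (i m n : ℕ) :
    rectangleSum fibWord i m n
      = fibFloorSum (i + n + m) - fibFloorSum (i + n) - (fibFloorSum (i + m) - fibFloorSum i) :=
  rectangleSum_eq_of_second_difference (g := fun j => fibFloor (j + 1))
    fibFloor_add_two_sub_fibFloor_add_one (fun j => by rw [fibFloorSum_succ, add_sub_cancel_left])
    i m n

theorem abs_rectangleSum_fibWord_succ_sub_le_one (i m n : ℕ) :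
    |rectangleSum fibWord (i + 1) m n - rectangleSum fibWord i m n| ≤ 1 := by
  have hdiff : rectangleSum fibWord (i + 1) m n - rectangleSum fibWord i m n
      = fibFloor (i + n + m + 1) - fibFloor (i + n + 1)
        - (fibFloor (i + m + 1) - fibFloor (i + 1)) := by
    simp only [rectangleSum_fibWord, add_right_comm i 1, add_right_comm _ 1 m, fibFloorSum_succ]
    ring
  rw [hdiff]
  apply abs_floor_sub_floor_sub_le_one
  push_cast
  ring

theorem rectangleSum_fibWord_add_sub {j x m : ℕ} (hm : 2 * m = Nat.fib (j + 2))
    (hlt : x + m < Nat.fib (j + 3)) :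
    rectangleSum fibWord (x + m) m m - rectangleSum fibWord x m m
      = 4 * (fibFloorSum (x + m) - fibFloorSum x) - 2 * fibFloorSum (Nat.fib (j + 2))
        + (m - 2 * x) * Nat.fib j := by
  have hx := fibFloorSum_fib_add ((x.le_add_right m).trans_lt hlt)
  have hxm := fibFloorSum_fib_add hlt
  have h_add_two : x + m + m = Nat.fib (j + 2) + x := by omega
  have h_add_three : Nat.fib (j + 2) + x + m = Nat.fib (j + 2) + (x + m) := by omega
  rw [rectangleSum_fibWord, rectangleSum_fibWord, h_add_two, h_add_three, hx, hxm]
  push_cast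
  ring

theorem rectangleSum_fibWord_half_fib_sub {s x m : ℕ} (hx : 4 * x + 1 = Nat.fib (3 * s + 2))
    (hm : 2 * m = Nat.fib (3 * s + 3)) :
    rectangleSum fibWord (x + m) m m - rectangleSum fibWord x m m = (-1) ^ s * (s + 1) := by
  have hxm : 4 * (x + m) + 1 = Nat.fib (3 * (s + 1) + 2) := by grind [Nat.fib_add_two]
  have hlt : x + m < Nat.fib (3 * s + 4) := by grind [Nat.fib_add_two]
  have hG := two_mul_fibFloorSum_fib (3 * s + 1)
  have hGx := thirtyTwo_mul_fibFloorSum_quarter_fib hx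
  have hGxm := thirtyTwo_mul_fibFloorSum_quarter_fib hxm
  have hx_cast : (4 * x + 1 : ℤ) = Nat.fib (3 * s + 2) := by exact_mod_cast hx
  have hm_cast : (2 * m : ℤ) = Nat.fib (3 * s + 3) := by exact_mod_cast hm
  have cassini := fib_mul_fib_add_two_sub_sq (3 * s)
  rw [rectangleSum_fibWord_add_sub (j := 3 * s + 1) hm hlt]
  apply mul_left_cancel₀ (show (8 : ℤ) ≠ 0 by norm_num)
  push_cast at hGxm
  simp only [mul_add, add_assoc, Nat.reduceAdd, Nat.reduceMul, natCast_fib_add_two, pow_add,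
    neg_one_pow_three_mul] at hG hGx hGxm hx_cast hm_cast cassini ⊢
  linear_combination hGxm - hGx - 8 * hG + 2 * cassini
    + 4 * Nat.fib (3 * s + 1) * (hm_cast - hx_cast)

/-- Parts (b) and (c) are the cases of odd and even `s`. -/
theorem rectangleSum_fibWord_fib_sub (s : ℕ) :
    rectangleSum fibWord ((Nat.fib (3 * s + 5) - 1) / 4)
        (Nat.fib (3 * s + 3) / 2) (Nat.fib (3 * s + 3) / 2)
      - rectangleSum fibWord ((Nat.fib (3 * s + 2) - 1) / 4)
        (Nat.fib (3 * s + 3) / 2) (Nat.fib (3 * s + 3) / 2) = (-1) ^ s * (s + 1) := by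
  have hmod := fib_three_mul_add_two_mod_four s
  have heven : 2 ∣ Nat.fib (3 * s + 3) := Nat.fib_dvd 3 (3 * (s + 1)) (dvd_mul_right _ _)
  have hx : 4 * ((Nat.fib (3 * s + 2) - 1) / 4) + 1 = Nat.fib (3 * s + 2) := by omega
  have hadd : (Nat.fib (3 * s + 5) - 1) / 4
      = (Nat.fib (3 * s + 2) - 1) / 4 + Nat.fib (3 * s + 3) / 2 := by
    grind [Nat.fib_add_two]
  rw [hadd]
  exact rectangleSum_fibWord_half_fib_sub hx (Nat.mul_div_cancel' heven)

theorem le_encard_range_rectangleSum_fibWord (k : ℕ) :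
    ((k + 1 : ℕ) : ℕ∞) ≤ (Set.range fun i : ℕ =>
      rectangleSum fibWord i (Nat.fib (3 * k) / 2) (Nat.fib (3 * k) / 2)).encard := by
  rcases k with _ | s
  · simp [Set.one_le_encard_iff_nonempty, Set.range_nonempty]
  · have hnatAbs : ((-1) ^ s * (s + 1) : ℤ).natAbs = s + 1 := by
      rw [Int.natAbs_mul, Int.natAbs_pow, Int.natAbs_neg, Int.natAbs_one, one_pow, one_mul]
      omega
    have hle := natAbs_sub_add_one_le_encard_range
      (g := fun i => rectangleSum fibWord i (Nat.fib (3 * s + 3) / 2) (Nat.fib (3 * s + 3) / 2))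
      (fun i => abs_rectangleSum_fibWord_succ_sub_le_one i _ _)
      ((Nat.fib (3 * s + 2) - 1) / 4) ((Nat.fib (3 * s + 5) - 1) / 4)
    simp only [rectangleSum_fibWord_fib_sub, hnatAbs] at hle
    exact hle

theorem theorem8 :
    (∀ k : ℕ,
      ((k + 1 : ℕ) : ℕ∞) ≤
        (Set.range fun i : ℕ =>
          rectangleSum fibWord i (Nat.fib (3 * k) / 2) (Nat.fib (3 * k) / 2)).encard) ∧
    (∀ n : ℕ, 1 ≤ n →
      rectangleSum fibWord ((Nat.fib (6 * n - 1) - 1) / 4)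
          (Nat.fib (6 * n) / 2) (Nat.fib (6 * n) / 2)
        - rectangleSum fibWord ((Nat.fib (6 * n + 2) - 1) / 4)
          (Nat.fib (6 * n) / 2) (Nat.fib (6 * n) / 2) = 2 * (n : ℤ)) ∧
    (∀ n : ℕ,
      rectangleSum fibWord ((Nat.fib (6 * n + 5) - 1) / 4)
          (Nat.fib (6 * n + 3) / 2) (Nat.fib (6 * n + 3) / 2)
        - rectangleSum fibWord ((Nat.fib (6 * n + 2) - 1) / 4)
          (Nat.fib (6 * n + 3) / 2) (Nat.fib (6 * n + 3) / 2) = 2 * (n : ℤ) + 1) := by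
  refine ⟨le_encard_range_rectangleSum_fibWord, fun n hn => ?_, fun n => ?_⟩
  · obtain ⟨n, rfl⟩ := Nat.exists_eq_add_of_le' hn
    have hdiff := rectangleSum_fibWord_fib_sub (2 * n + 1)
    rw [show 3 * (2 * n + 1) + 5 = 6 * (n + 1) + 2 by ring,
      show 3 * (2 * n + 1) + 3 = 6 * (n + 1) by ring,
      show 3 * (2 * n + 1) + 2 = 6 * (n + 1) - 1 by omega, (odd_two_mul_add_one n).neg_one_pow]
      at hdiff
    push_cast at hdiff ⊢
    linear_combination -hdiff
  · have hdiff := rectangleSum_fibWord_fib_sub (2 * n)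
    rw [← mul_assoc, (even_two_mul n).neg_one_pow] at hdiff
    push_cast at hdiff
    linear_combination hdiff
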